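/- A two-way probabilistic finite automaton (2PFA) has a finite state set $Q$ with a start state and disjoint sets of accepting and rejecting states. On an input $w$, its tape holds $w$ between a left and a right end-marker, and it starts in its start state on the left end-marker. At each step it draws, from a probability distribution determined by its state and the scanned symbol, a new state and a head movement by $-1$, $0$ or $1$, the head staying between the end-markers; it halts on entering an accepting or a rejecting state. Its space is $S=\log_2|Q|$. It recognizes a language $L\subseteq\Sigma^*$ with error $\varepsilon$ if it accepts every $w\in L$ with probability at least $1-\varepsilon$ and rejects every $w\in\Sigma^*\setminus L$ with probability at least $1-\varepsilon$. For bits, let $\mathrm{NE}(a,b,c)=0$ if $a=b=c$ and $\mathrm{NE}(a,b,c)=1$ otherwise. Let $\mathrm{NE}^0(z_1)=z_1$ and, for $d>0$, $\mathrm{NE}^d(z_1,\dots,z_{3^d})=\mathrm{NE}\big(\mathrm{NE}^{d-1}(z_1,\dots,z_{3^{d-1}}),\mathrm{NE}^{d-1}(z_{3^{d-1}+1},\dots,z_{2\cdot 3^{d-1}}),\mathrm{NE}^{d-1}(z_{2\cdot 3^{d-1}+1},\dots,z_{3^d})\big)$. For $n=3^d$ and $x,y\in\{0,1\}^n$ let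 $\mathrm{RNE}(x,y)=\mathrm{NE}^d(x_1\wedge y_1,\dots,x_n\wedge y_n)$, and let $L_{NE}(n)=\{x\#^ny : x,y\in\{0,1\}^n,\ \mathrm{RNE}(x,y)=1\}$, a language over $\Sigma=\{0,1,\#\}$. **Theorem.** Any 2PFA recognizing $L_{NE}(n)$ with error less than $1/3$ in time $T$ with space $S$ satisfies $TS=\Omega(n^2)$. That is, there is an absolute constant $c>0$ such that for all $d\ge 0$, with $n=3^d$, every $\varepsilon\in[0,1/3)$, and every 2PFA with space $S$ that recognizes $L_{NE}(n)$ with error $\varepsilon$ and whose expected number of steps before halting is at most $T$ on every input of length $3n$ (in particular, if it always halts within $T$ steps), we have $TS\ge c\,n^2$. -/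

import Mathlib

open scoped NNReal ENNReal

noncomputable section

/-- Contents of a tape cell: an input symbol or one of the two end-markers. -/
inductive TapeSymbol (A : Type*) where
  | leftEnd : TapeSymbol A
  | rightEnd : TapeSymbol A
  | letter : A → TapeSymbol A

/-- Head movements. -/
inductive HeadMove where
  | left : HeadMove
  | stay : HeadMove
  | right : HeadMove

/-- A two-way probabilistic finite automaton over the alphabet `A` with state set `Q`. In the
non-halting state `q`, scanning `σ`, it draws its next state and head movement from `δ q σ`
(arbitrary real probabilities). The automaton halts on entering a state of `acc` or `rej`; the
values of `δ` at such states are never used. -/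
structure TwoPFA (A : Type*) (Q : Type*) where
  start : Q
  acc : Set Q
  rej : Set Q
  disjoint_acc_rej : Disjoint acc rej
  δ : Q → TapeSymbol A → PMF (Q × HeadMove)

/-- The symbol in cell `i` of the tape holding `w`: the left end-marker is in cell `0`, the word is
in cells `1, …, |w|`, and the right end-marker is in cell `|w| + 1`. -/
def tapeSymbolAt {A : Type*} (w : List A) (i : Fin (w.length + 2)) : TapeSymbol A :=
  match i.val with
  | 0 => TapeSymbol.leftEnd
  | k + 1 =>
    match w[k]? with
    | some a => TapeSymbol.letter a
    | none => TapeSymbol.rightEnd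

/-- Head movement on the tape cells `0, …, m + 1`. A movement beyond an end-marker leaves the head
where it is (this is immaterial for automata that never attempt such a movement). -/
def moveHead {m : ℕ} (i : Fin (m + 2)) : HeadMove → Fin (m + 2)
  | HeadMove.left => ⟨i.val - 1, by omega⟩
  | HeadMove.stay => i
  | HeadMove.right => ⟨min (i.val + 1) (m + 1), by omega⟩

namespace TwoPFA

variable {A : Type*} {Q : Type*}

/-- The halting states. -/
def halting (M : TwoPFA A Q) : Set Q := M.acc ∪ M.rej

open Classical in
/-- One step of the automaton on input `w`. A configuration is a pair of a state and a head
position; halted configurations do not change. -/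
def step (M : TwoPFA A Q) (w : List A) (c : Q × Fin (w.length + 2)) :
    PMF (Q × Fin (w.length + 2)) :=
  if c.1 ∈ M.halting then PMF.pure c
  else (M.δ c.1 (tapeSymbolAt w c.2)).map fun p => (p.1, moveHead c.2 p.2)

/-- The distribution of the configuration after `k` steps on input `w`; the automaton starts in its
start state on the left end-marker. -/
def configAfter (M : TwoPFA A Q) (w : List A) : ℕ → PMF (Q × Fin (w.length + 2))
  | 0 => PMF.pure (M.start, 0)
  | k + 1 => (configAfter M w k).bind (M.step w)

/-- The probability that after `k` steps on input `w` the state is in `X`. -/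
def stateProb (M : TwoPFA A Q) (w : List A) (k : ℕ) (X : Set Q) : ℝ≥0∞ :=
  (M.configAfter w k).toOuterMeasure {c | c.1 ∈ X}

/-- The probability that `M` ever accepts `w`. As halted configurations do not change, this is the
supremum over `k` of the probability that it has accepted within `k` steps. -/
def acceptProb (M : TwoPFA A Q) (w : List A) : ℝ≥0∞ :=
  ⨆ k : ℕ, M.stateProb w k M.acc

/-- The probability that `M` ever rejects `w`. -/
def rejectProb (M : TwoPFA A Q) (w : List A) : ℝ≥0∞ :=
  ⨆ k : ℕ, M.stateProb w k M.rej

/-- The expected number of steps `τ` before `M` halts on `w` (possibly `∞`), computed by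
`E[τ] = ∑ k ≥ 0, P(τ > k)`. -/
def expectedTime (M : TwoPFA A Q) (w : List A) : ℝ≥0∞ :=
  ∑' k : ℕ, M.stateProb w k (M.halting)ᶜ

/-- `M` recognizes the language `L` with error `ε`. -/
def Recognizes (M : TwoPFA A Q) (L : Language A) (ε : ℝ) : Prop :=
  (∀ w ∈ L, ENNReal.ofReal (1 - ε) ≤ M.acceptProb w) ∧
    (∀ w ∉ L, ENNReal.ofReal (1 - ε) ≤ M.rejectProb w)

/-- The space used by `M`: the binary logarithm of its number of states. -/
def space (_M : TwoPFA A Q) [Fintype Q] : ℝ :=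
  Real.logb 2 (Fintype.card Q)

end TwoPFA

/-- `NE(a, b, c)` is `0` if `a = b = c` and `1` otherwise. -/
def NE (a b c : Bool) : Bool :=
  !(a == b && b == c)

/-- The iterated function `NE^d` on `3 ^ d` bits. -/
def NEiter : (d : ℕ) → (Fin (3 ^ d) → Bool) → Bool
  | 0, x => x ⟨0, by norm_num⟩
  | d + 1, x =>
    NE (NEiter d fun i => x ⟨i.val, by have := i.isLt; rw [pow_succ]; omega⟩)
      (NEiter d fun i => x ⟨3 ^ d + i.val, by have := i.isLt; rw [pow_succ]; omega⟩)
      (NEiter d fun i => x ⟨2 * 3 ^ d + i.val, by have := i.isLt; rw [pow_succ]; omega⟩)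

/-- `RNE(x, y) = NE^d(x₁ ∧ y₁, …, xₙ ∧ yₙ)`, where `n = 3 ^ d`. -/
def RNE (d : ℕ) (x y : Fin (3 ^ d) → Bool) : Bool :=
  NEiter d fun i => x i && y i

/-- The alphabet `{0, 1, #}`. -/
inductive InputSymbol where
  | bit : Bool → InputSymbol
  | hash : InputSymbol

/-- The word `x #ⁿ y`. -/
def paddedWord {n : ℕ} (x y : Fin n → Bool) : List InputSymbol :=
  (List.ofFn fun i => InputSymbol.bit (x i)) ++ List.replicate n InputSymbol.hash ++
    (List.ofFn fun i => InputSymbol.bit (y i))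

/-- The language `L_NE(n)` for `n = 3 ^ d`. -/
def LNE (d : ℕ) : Language InputSymbol :=
  {w | ∃ x y : Fin (3 ^ d) → Bool, RNE d x y = true ∧ w = paddedWord x y}

end

/-! `NE` is 0 at three zeros and 1 when exactly one argument is 1, so NE^d is 0 at the zero string
and 1 at every string with a single 1. An automaton for the language therefore rejects disjoint
pairs and accepts pairs meeting in one point: it solves unique disjointness.

Cut the tape inside the padding, after cell c with n ≤ c < 2n, so that one side depends only on x
and the other only on y. The probability of rejecting with at most k crossings of the cut is a sum,
over sequences of at most k states, of products f(x) g(y) with values in [0, 1]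
(`corruptionBound_boundedReject`), and there are fewer than 2|Q|^k such sequences. A step crosses at
most one cut, so the expected crossings of the n cuts add up to at most T. By Markov
(`stateValue_rej_le`), for k about 15T/n the probabilities for disjoint pairs still average at least
2/3 - 1/15 = 3/5 over the cuts, whereas for pairs meeting once each is at most 1/3.

The corruption bound (`hitSum_mul_ge`) says that a product f(x) g(y) has mean over random pairs
meeting once at least 5/8 of its mean over random disjoint pairs, up to an error exponentially small
in n. As 5/8 · 3/5 > 1/3, the errors must add up to a constant, which forces |Q|^k ≥ exp(Ω(n)), that
is, (T/n) S = Ω(n).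

The corruption bound is proved by induction on coordinates with an entropy potential. If forcing a
coordinate to (1, 1) loses much mass, then the averages of f or of g differ noticeably between the
two values of that coordinate, and the strict concavity of `negMulLog` pays for the loss. -/

noncomputable section

/-! ### Averages over disjoint and uniquely intersecting pairs -/

open Real

/-- The average of `N` over pairs `(x, y)` whose coordinates are drawn independently from
`(0, 0)`, `(0, 1)`, `(1, 0)` with probabilities `1/2`, `1/4`, `1/4`. -/
def disjAvg : (n : ℕ) → ((Fin n → Bool) → (Fin n → Bool) → ℝ) → ℝ
  | 0, N => N ![] ![]
  | n + 1, N =>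
    disjAvg n (fun x y => N (Matrix.vecCons false x) (Matrix.vecCons false y)) / 2 +
      disjAvg n (fun x y => N (Matrix.vecCons false x) (Matrix.vecCons true y)) / 4 +
      disjAvg n (fun x y => N (Matrix.vecCons true x) (Matrix.vecCons false y)) / 4

/-- The sum over `i` of the average of `N` over the pairs drawn as in `disjAvg`, except that
coordinate `i` is `(1, 1)`. -/
def hitSum : (n : ℕ) → ((Fin n → Bool) → (Fin n → Bool) → ℝ) → ℝ
  | 0, _ => 0
  | n + 1, N =>
    disjAvg n (fun x y => N (Matrix.vecCons true x) (Matrix.vecCons true y)) +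
      hitSum n (fun x y => N (Matrix.vecCons false x) (Matrix.vecCons false y)) / 2 +
      hitSum n (fun x y => N (Matrix.vecCons false x) (Matrix.vecCons true y)) / 4 +
      hitSum n (fun x y => N (Matrix.vecCons true x) (Matrix.vecCons false y)) / 4

/-- The average of `φ` over the uniform distribution on the cube. -/
def boolMean : (n : ℕ) → ((Fin n → Bool) → ℝ) → ℝ
  | 0, φ => φ ![]
  | n + 1, φ =>
    (boolMean n (fun D => φ (Matrix.vecCons true D)) +
      boolMean n (fun D => φ (Matrix.vecCons false D))) / 2

/-- The average of `f` over the subcube in which the coordinates `i` with `D i = s` are free and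
the others are `0`. -/
def subcubeAvg (s : Bool) : (n : ℕ) → (Fin n → Bool) → ((Fin n → Bool) → ℝ) → ℝ
  | 0, _, f => f ![]
  | n + 1, D, f =>
    if D 0 = s then
      (subcubeAvg s n (Matrix.vecTail D) (fun x => f (Matrix.vecCons false x)) +
        subcubeAvg s n (Matrix.vecTail D) (fun x => f (Matrix.vecCons true x))) / 2
    else subcubeAvg s n (Matrix.vecTail D) (fun x => f (Matrix.vecCons false x))

theorem disjAvg_add : ∀ (n : ℕ) (N N' : (Fin n → Bool) → (Fin n → Bool) → ℝ),
    disjAvg n (fun x y => N x y + N' x y) = disjAvg n N + disjAvg n N'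
  | 0, _, _ => rfl
  | n + 1, N, N' => by simp only [disjAvg, disjAvg_add n]; ring

theorem disjAvg_mul_const : ∀ (n : ℕ) (N : (Fin n → Bool) → (Fin n → Bool) → ℝ) (c : ℝ),
    disjAvg n (fun x y => N x y * c) = disjAvg n N * c
  | 0, _, _ => rfl
  | n + 1, N, c => by simp only [disjAvg, disjAvg_mul_const n]; ring

theorem disjAvg_zero (n : ℕ) : disjAvg n (fun _ _ => 0) = 0 := by
  simpa using disjAvg_mul_const n (fun _ _ => 0) 0

theorem disjAvg_const : ∀ (n : ℕ) (c : ℝ), disjAvg n (fun _ _ => c) = c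
  | 0, _ => rfl
  | n + 1, c => by simp only [disjAvg, disjAvg_const n]; ring

theorem hitSum_add : ∀ (n : ℕ) (N N' : (Fin n → Bool) → (Fin n → Bool) → ℝ),
    hitSum n (fun x y => N x y + N' x y) = hitSum n N + hitSum n N'
  | 0, _, _ => by simp [hitSum]
  | n + 1, N, N' => by simp only [hitSum, disjAvg_add, hitSum_add n]; ring

theorem hitSum_zero : ∀ n : ℕ, hitSum n (fun _ _ => 0) = 0
  | 0 => rfl
  | n + 1 => by simp only [hitSum, disjAvg_zero, hitSum_zero n]; ring

theorem disjAvg_sum {ι : Type*} (n : ℕ) (s : Finset ι)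
    (N : ι → (Fin n → Bool) → (Fin n → Bool) → ℝ) :
    disjAvg n (fun x y => ∑ i ∈ s, N i x y) = ∑ i ∈ s, disjAvg n (N i) := by
  classical
  induction s using Finset.induction_on with
  | empty => simp [disjAvg_zero]
  | insert i s hi ih => simp only [Finset.sum_insert hi, disjAvg_add, ih]

theorem disjAvg_mono_of_disjoint : ∀ (n : ℕ) {N N' : (Fin n → Bool) → (Fin n → Bool) → ℝ},
    (∀ x y, (∀ i, (x i && y i) = false) → N x y ≤ N' x y) → disjAvg n N ≤ disjAvg n N'
  | 0, N, N', h => h _ _ (fun i => i.elim0)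
  | n + 1, N, N', h => by
    have key : ∀ a b : Bool, (a && b) = false →
        disjAvg n (fun x y => N (Matrix.vecCons a x) (Matrix.vecCons b y)) ≤
          disjAvg n (fun x y => N' (Matrix.vecCons a x) (Matrix.vecCons b y)) := by
      intro a b hab
      refine disjAvg_mono_of_disjoint n fun x y hxy => h _ _ fun i => ?_
      refine Fin.cases ?_ (fun j => ?_) i
      · simpa using hab
      · simpa using hxy j
    have h1 := key false false rfl
    have h2 := key false true rfl
    have h3 := key true false rfl
    simp only [disjAvg]
    linarith

/-- The two sets have exactly one common element. -/
def MeetOnce {n : ℕ} (x y : Fin n → Bool) : Prop :=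
  ∃ i, (x i && y i) = true ∧ ∀ j, j ≠ i → (x j && y j) = false

theorem MeetOnce.vecCons {n : ℕ} {x y : Fin n → Bool} (h : MeetOnce x y) {a b : Bool}
    (hab : (a && b) = false) : MeetOnce (Matrix.vecCons a x) (Matrix.vecCons b y) := by
  obtain ⟨i, hi, hj⟩ := h
  refine ⟨i.succ, by simpa using hi, fun j => Fin.cases ?_ (fun k => ?_) j⟩
  · intro _
    simpa using hab
  · intro hk
    simpa using hj k (fun h => hk (by rw [h]))

theorem hitSum_le : ∀ (n : ℕ) {N : (Fin n → Bool) → (Fin n → Bool) → ℝ} {c : ℝ},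
    (∀ x y, MeetOnce x y → N x y ≤ c) → hitSum n N ≤ n * c
  | 0, _, _, _ => by simp [hitSum]
  | n + 1, N, c, h => by
    have key : ∀ a b : Bool, (a && b) = false →
        hitSum n (fun x y => N (Matrix.vecCons a x) (Matrix.vecCons b y)) ≤ n * c :=
      fun a b hab => hitSum_le n fun x y hxy => h _ _ (hxy.vecCons hab)
    have h0 : disjAvg n (fun x y => N (Matrix.vecCons true x) (Matrix.vecCons true y)) ≤ c := by
      rw [← disjAvg_const n c]
      refine disjAvg_mono_of_disjoint n fun x y hxy => h _ _ ⟨0, by simp, fun j => ?_⟩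
      refine Fin.cases (fun h => absurd rfl h) (fun k _ => ?_) j
      simpa using hxy k
    have h1 := key false false rfl
    have h2 := key false true rfl
    have h3 := key true false rfl
    simp only [hitSum]
    push_cast
    linarith

theorem boolMean_add : ∀ (n : ℕ) (φ ψ : (Fin n → Bool) → ℝ),
    boolMean n (fun D => φ D + ψ D) = boolMean n φ + boolMean n ψ
  | 0, _, _ => rfl
  | n + 1, φ, ψ => by simp only [boolMean, boolMean_add n]; ring

theorem boolMean_mul_const : ∀ (n : ℕ) (φ : (Fin n → Bool) → ℝ) (c : ℝ),
    boolMean n (fun D => φ D * c) = boolMean n φ * c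
  | 0, _, _ => rfl
  | n + 1, φ, c => by simp only [boolMean, boolMean_mul_const n]; ring

theorem boolMean_const : ∀ (n : ℕ) (c : ℝ), boolMean n (fun _ => c) = c
  | 0, _ => rfl
  | n + 1, c => by simp only [boolMean, boolMean_const n]; ring

theorem boolMean_mono : ∀ (n : ℕ) {φ ψ : (Fin n → Bool) → ℝ}, (∀ D, φ D ≤ ψ D) →
    boolMean n φ ≤ boolMean n ψ
  | 0, _, _, h => h _
  | n + 1, φ, ψ, h => by
    have h1 := boolMean_mono n (fun D => h (Matrix.vecCons true D))
    have h2 := boolMean_mono n (fun D => h (Matrix.vecCons false D))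
    simp only [boolMean]
    linarith

theorem subcubeAvg_nonneg (s : Bool) : ∀ (n : ℕ) (D : Fin n → Bool) {f : (Fin n → Bool) → ℝ},
    (∀ x, 0 ≤ f x) → 0 ≤ subcubeAvg s n D f
  | 0, _, _, h => h _
  | n + 1, D, f, h => by
    have h0 := subcubeAvg_nonneg s n (Matrix.vecTail D) (fun x => h (Matrix.vecCons false x))
    have h1 := subcubeAvg_nonneg s n (Matrix.vecTail D) (fun x => h (Matrix.vecCons true x))
    simp only [subcubeAvg]
    split_ifs <;> linarith

/-- For each coordinate a fair coin D decides whether x or y gets a fair bit there, the other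
getting 0. This reproduces the weights 1/2, 1/4, 1/4, and given D the two strings are independent.
-/
theorem disjAvg_mul : ∀ (n : ℕ) (f g : (Fin n → Bool) → ℝ),
    disjAvg n (fun x y => f x * g y) =
      boolMean n fun D => subcubeAvg true n D f * subcubeAvg false n D g
  | 0, _, _ => rfl
  | n + 1, f, g => by
    simp only [disjAvg, disjAvg_mul n, boolMean, subcubeAvg, Matrix.cons_val_zero,
      Matrix.tail_cons, if_true, Bool.false_eq_true, Bool.true_eq_false, if_false]
    simp only [div_eq_mul_inv, ← boolMean_mul_const, ← boolMean_add]
    congr 1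
    ext D
    ring

/-! ### The entropy argument for a single rectangle -/

/-- A lower bound on the entropy of a nonnegative function on two points. -/
theorem sq_sqrt_sub_sqrt_le_negMulLog {u v : ℝ} (hu : 0 ≤ u) (hv : 0 ≤ v) :
    (√u - √v) ^ 2 / 4 ≤ negMulLog ((u + v) / 2) - (negMulLog u + negMulLog v) / 2 := by
  rcases (add_nonneg hu hv).eq_or_lt with h0 | h0
  · have hu0 : u = 0 := by linarith
    have hv0 : v = 0 := by linarith
    simp [hu0, hv0]
  set m := (u + v) / 2 with hm
  have hmpos : 0 < m := by positivity
  -- This is log s ≤ s - 1 at s = √m/√t. The mean of the cases t = u and t = v is 2m - √m (√u + √v),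
  -- and completing the square in √m leaves (√u - √v)²/4.
  have key : ∀ t : ℝ, 0 ≤ t → 2 * t - 2 * (√t * √m) ≤ t * log t - t * log m := by
    intro t ht
    rcases ht.eq_or_lt with rfl | ht
    · simp
    have hst := sqrt_pos.2 ht
    have hsm := sqrt_pos.2 hmpos
    have h1 := log_le_sub_one_of_pos (div_pos hsm hst)
    rw [log_div hsm.ne' hst.ne', log_sqrt ht.le, log_sqrt hmpos.le] at h1
    have h2 : t * (√m / √t) = √t * √m := by
      rw [mul_div_assoc', div_eq_iff hst.ne', mul_right_comm, mul_self_sqrt ht.le]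
    nlinarith [mul_le_mul_of_nonneg_left h1 ht.le]
  have h1 := key u hu
  have h2 := key v hv
  have e1 : √u ^ 2 = u := sq_sqrt hu
  have e2 : √v ^ 2 = v := sq_sqrt hv
  have e3 : √m ^ 2 = m := sq_sqrt hmpos.le
  have e4 : negMulLog m = - (u * log m + v * log m) / 2 := by rw [negMulLog, hm]; ring
  rw [e4, negMulLog, negMulLog]
  nlinarith [sq_nonneg (√m - (√u + √v) / 2)]

/-- Put p = r₀s₀, A = r₁s₀, B = r₀s₁. Since r₁s₁ · p = AB, the bound (r₁s₁)² ≥ 2AB - p² reduces the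
claim to a quadratic form in p, A, B. At A = B = p it reads 3/4 ≤ 1, and the weight 7 absorbs the
deviations A - p and B - p. -/
theorem corruption_pointwise_sqrt {r₀ s₀ : ℝ} (r₁ s₁ : ℝ) (hr₀ : 0 ≤ r₀) (hs₀ : 0 ≤ s₀) :
    3 / 4 * ((r₀ * s₀) ^ 2 / 2 + (r₀ * s₁) ^ 2 / 4 + (r₁ * s₀) ^ 2 / 4) ≤
      (r₁ * s₁) ^ 2 + 7 * (s₀ ^ 2 * (r₀ - r₁) ^ 2 + r₀ ^ 2 * (s₀ - s₁) ^ 2) := by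
  rcases (mul_nonneg hr₀ hs₀).eq_or_lt with h | h
  · rcases mul_eq_zero.1 h.symm with rfl | rfl
    · nlinarith [sq_nonneg (r₁ * s₀), sq_nonneg (r₁ * s₁)]
    · nlinarith [sq_nonneg (r₀ * s₁), sq_nonneg (r₁ * s₁)]
  · have h1 : 2 * (r₁ * s₁) * (r₀ * s₀) ≤ (r₁ * s₁) ^ 2 + (r₀ * s₀) ^ 2 := by
      nlinarith [sq_nonneg (r₁ * s₁ - r₀ * s₀)]
    nlinarith [sq_nonneg (r₁ * s₀ + r₀ * s₁ - 2 * (r₀ * s₀)),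
      sq_nonneg (r₁ * s₀ - r₀ * s₀ + 3/20 * (r₀ * s₀)),
      sq_nonneg (r₀ * s₁ - r₀ * s₀ + 3/20 * (r₀ * s₀))]

/-- By the product rule for `negMulLog`, the entropy terms combine into 28 times b₀ · (Jensen gap of
a₀, a₁) + a₀ · (Jensen gap of b₀, b₁). Each gap is at least a quarter of a squared difference of
square roots, which yields the weight 28/4 = 7. -/
theorem corruption_pointwise {a₀ a₁ b₀ b₁ : ℝ} (ha₀ : 0 ≤ a₀) (ha₁ : 0 ≤ a₁) (hb₀ : 0 ≤ b₀)
    (hb₁ : 0 ≤ b₁) :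
    (a₀ * b₀ / 2 + a₀ * b₁ / 4 + a₁ * b₀ / 4) * (3 / 4) +
        (negMulLog (a₀ * b₀) / 2 + negMulLog (a₀ * b₁) / 4 + negMulLog (a₁ * b₀) / 4) * 56 ≤
      a₁ * b₁ +
        (negMulLog ((a₀ + a₁) / 2 * b₀) + negMulLog (a₀ * ((b₀ + b₁) / 2))) * 28 := by
  have h := corruption_pointwise_sqrt (√a₁) (√b₁) (sqrt_nonneg a₀) (sqrt_nonneg b₀)
  simp only [mul_pow, sq_sqrt, ha₀, ha₁, hb₀, hb₁] at h
  have h1 := mul_le_mul_of_nonneg_left (sq_sqrt_sub_sqrt_le_negMulLog ha₀ ha₁) hb₀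
  have h2 := mul_le_mul_of_nonneg_left (sq_sqrt_sub_sqrt_le_negMulLog hb₀ hb₁) ha₀
  simp only [negMulLog_mul]
  linarith

/-- Induction on coordinates. The hypothesis for the three disjoint values of the first coordinate
handles the hits elsewhere; the share 3/4 of the first coordinate itself is paid, for each D on the
rest, by the hit (1, 1) and the increase in entropy. -/
theorem hitSum_mul_ge_entropy : ∀ (n : ℕ) {f g : (Fin n → Bool) → ℝ}, (∀ x, 0 ≤ f x) →
    (∀ x, f x ≤ 1) → (∀ y, 0 ≤ g y) → (∀ y, g y ≤ 1) →
    3 / 4 * n * disjAvg n (fun x y => f x * g y) ≤ hitSum n (fun x y => f x * g y) +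
      56 * boolMean n fun D => negMulLog (subcubeAvg true n D f * subcubeAvg false n D g)
  | 0, f, g, hf, hf', hg, hg' => by
    have h := negMulLog_nonneg (mul_nonneg (hf ![]) (hg ![]))
      (mul_le_one₀ (hf' ![]) (hg ![]) (hg' ![]))
    simpa [hitSum, boolMean, subcubeAvg] using h
  | n + 1, f, g, hf, hf', hg, hg' => by
    have ih : ∀ a b : Bool, _ := fun a b =>
      hitSum_mul_ge_entropy n (f := fun x => f (Matrix.vecCons a x))
        (g := fun y => g (Matrix.vecCons b y)) (fun _ => hf _) (fun _ => hf' _) (fun _ => hg _)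
        (fun _ => hg' _)
    have h00 := ih false false
    have h01 := ih false true
    have h10 := ih true false
    have hpt := boolMean_mono n fun D => corruption_pointwise
      (subcubeAvg_nonneg true n D (fun x => hf (Matrix.vecCons false x)))
      (subcubeAvg_nonneg true n D (fun x => hf (Matrix.vecCons true x)))
      (subcubeAvg_nonneg false n D (fun x => hg (Matrix.vecCons false x)))
      (subcubeAvg_nonneg false n D (fun x => hg (Matrix.vecCons true x)))
    simp only [disjAvg, hitSum, boolMean, subcubeAvg, Matrix.cons_val_zero,
      Matrix.tail_cons, if_true, Bool.false_eq_true, Bool.true_eq_false, if_false]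
    simp only [div_eq_mul_inv,
      boolMean_mul_const, boolMean_add, ← disjAvg_mul] at hpt
    simp only [div_eq_mul_inv] at h00 h01 h10 ⊢
    push_cast
    linarith

/-- The tangent at exp(-K), with its slope K - 1 relaxed to K. Entropy is thus a small multiple of
the mass, up to a tiny additive error. -/
theorem negMulLog_le_mul_add_exp {t : ℝ} (ht : 0 ≤ t) (K : ℝ) :
    negMulLog t ≤ K * t + exp (-K) := by
  rcases ht.eq_or_lt with rfl | ht
  · simp [exp_nonneg]
  have h := log_le_sub_one_of_pos (div_pos (exp_pos (-K)) ht)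
  rw [log_div (exp_pos _).ne' ht.ne', log_exp] at h
  have h2 : t * (exp (-K) / t) = exp (-K) := by field_simp
  rw [negMulLog]
  nlinarith [mul_le_mul_of_nonneg_left h ht.le]

/-- The corruption bound for unique disjointness. -/
theorem hitSum_mul_ge {n : ℕ} {f g : (Fin n → Bool) → ℝ} (hf : ∀ x, 0 ≤ f x)
    (hf' : ∀ x, f x ≤ 1) (hg : ∀ y, 0 ≤ g y) (hg' : ∀ y, g y ≤ 1) :
    5 / 8 * n * disjAvg n (fun x y => f x * g y) ≤
      hitSum n (fun x y => f x * g y) + 56 * exp (-(n / 448 : ℝ)) := by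
  have h := hitSum_mul_ge_entropy n hf hf' hg hg'
  -- With K = n/448 the entropy term costs 56K = n/8 of the mass, lowering 3/4 to 5/8.
  have h2 := boolMean_mono n fun D => negMulLog_le_mul_add_exp
    (mul_nonneg (subcubeAvg_nonneg true n D hf) (subcubeAvg_nonneg false n D hg)) (n / 448)
  simp only [mul_comm (n / 448 : ℝ), boolMean_add, boolMean_mul_const, boolMean_const,
    ← disjAvg_mul] at h2
  linarith

/-! ### Corruption bounds for sums of rectangles -/

/-- The corruption bound holds for `N` and all its products with functions of one argument,
with `R` times the error of a single rectangle. -/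
def CorruptionBound (n : ℕ) (R : ℝ) (N : (Fin n → Bool) → (Fin n → Bool) → ℝ) : Prop :=
  ∀ f g : (Fin n → Bool) → ℝ, (∀ x, 0 ≤ f x) → (∀ x, f x ≤ 1) → (∀ y, 0 ≤ g y) →
    (∀ y, g y ≤ 1) →
    5 / 8 * n * disjAvg n (fun x y => f x * g y * N x y) ≤
      hitSum n (fun x y => f x * g y * N x y) + R * (56 * exp (-(n / 448 : ℝ)))

namespace CorruptionBound

variable {n : ℕ} {R R' : ℝ} {N N' : (Fin n → Bool) → (Fin n → Bool) → ℝ}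

theorem one : CorruptionBound n 1 fun _ _ => 1 := fun f g hf hf' hg hg' => by
  simpa using hitSum_mul_ge hf hf' hg hg'

theorem zero : CorruptionBound n 0 fun _ _ => 0 := fun f g _ _ _ _ => by
  simp [disjAvg_zero, hitSum_zero]

theorem add (h : CorruptionBound n R N) (h' : CorruptionBound n R' N') :
    CorruptionBound n (R + R') fun x y => N x y + N' x y := fun f g hf hf' hg hg' => by
  have h1 := h f g hf hf' hg hg'
  have h2 := h' f g hf hf' hg hg'
  simp only [mul_add, disjAvg_add, hitSum_add]
  linarith

theorem sum {ι : Type*} (s : Finset ι) {N : ι → (Fin n → Bool) → (Fin n → Bool) → ℝ}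
    (h : ∀ i, CorruptionBound n R (N i)) :
    CorruptionBound n (s.card * R) fun x y => ∑ i ∈ s, N i x y := by
  classical
  induction s using Finset.induction_on with
  | empty => simpa using zero
  | insert i s hi ih =>
    simp only [Finset.sum_insert hi, Finset.card_insert_of_notMem hi]
    convert (h i).add ih using 1
    push_cast
    ring

/-- The factor is absorbed into f, so R does not grow; this is why the definition quantifies over f
and g. -/
theorem mul_left (h : CorruptionBound n R N) {a : (Fin n → Bool) → ℝ} (ha : ∀ x, 0 ≤ a x)
    (ha' : ∀ x, a x ≤ 1) : CorruptionBound n R fun x y => a x * N x y :=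
  fun f g hf hf' hg hg' => by
  have h1 := h (fun x => f x * a x) g (fun x => mul_nonneg (hf x) (ha x))
    (fun x => mul_le_one₀ (hf' x) (ha x) (ha' x)) hg hg'
  have e : (fun x y => f x * g y * (a x * N x y)) = fun x y => f x * a x * g y * N x y := by
    ext x y; ring
  rw [e]
  exact h1

theorem mul_right (h : CorruptionBound n R N) {b : (Fin n → Bool) → ℝ} (hb : ∀ y, 0 ≤ b y)
    (hb' : ∀ y, b y ≤ 1) : CorruptionBound n R fun x y => b y * N x y :=
  fun f g hf hf' hg hg' => by
  have h1 := h f (fun y => g y * b y) hf hf' (fun y => mul_nonneg (hg y) (hb y))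
    (fun y => mul_le_one₀ (hg' y) (hb y) (hb' y))
  have e : (fun x y => f x * g y * (b y * N x y)) = fun x y => f x * (g y * b y) * N x y := by
    ext x y; ring
  rw [e]
  exact h1

theorem apply (h : CorruptionBound n R N) :
    5 / 8 * n * disjAvg n N ≤ hitSum n N + R * (56 * exp (-(n / 448 : ℝ))) := by
  simpa using h (fun _ => 1) (fun _ => 1) (by simp) (by simp) (by simp) (by simp)

end CorruptionBound

end

/-! ### First-step recursions for the automaton and its crossings of a cut -/

noncomputable section

instance : Fintype HeadMove where
  elems := ⟨{HeadMove.left, HeadMove.stay, HeadMove.right}, by simp⟩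
  complete := by rintro (_ | _ | _) <;> simp

/-- The symbol in cell `i` of the tape holding `w`, for an arbitrary natural number `i`. -/
def tapeSymbolNat {A : Type*} (w : List A) : ℕ → TapeSymbol A
  | 0 => TapeSymbol.leftEnd
  | k + 1 =>
    match w[k]? with
    | some a => TapeSymbol.letter a
    | none => TapeSymbol.rightEnd

/-- Head movement on natural numbers, with right end-marker in cell `m + 1`. -/
def moveNat (m i : ℕ) : HeadMove → ℕ
  | HeadMove.left => i - 1
  | HeadMove.stay => i
  | HeadMove.right => if i ≤ m then i + 1 else i

theorem moveHead_val {m : ℕ} (i : Fin (m + 2)) (d : HeadMove) :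
    (moveHead i d).val = moveNat m i.val d := by
  have := i.isLt
  cases d <;> simp only [moveHead, moveNat]
  split_ifs <;> omega

theorem moveNat_le (m i : ℕ) (d : HeadMove) : moveNat m i d ≤ i + 1 := by
  cases d <;> simp only [moveNat]
  · omega
  · omega
  · split_ifs <;> omega

theorem le_moveNat (m i : ℕ) (d : HeadMove) : i ≤ moveNat m i d + 1 := by
  cases d <;> simp only [moveNat]
  · omega
  · omega
  · split_ifs <;> omega

namespace TwoPFA

section

variable {A Q : Type*} {M : TwoPFA A Q}

theorem rej_subset_halting : M.rej ⊆ M.halting := Set.subset_union_right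

theorem acc_subset_halting : M.acc ⊆ M.halting := Set.subset_union_left

variable (M) (w : List A)

/-- The distribution of the configuration after `k` steps, starting at `c`. -/
def runFrom (c : Q × Fin (w.length + 2)) : ℕ → PMF (Q × Fin (w.length + 2))
  | 0 => PMF.pure c
  | k + 1 => (runFrom c k).bind (M.step w)

/-- The run is defined by appending a last step, while the recursions below condition on the first
one. -/
theorem runFrom_succ (c : Q × Fin (w.length + 2)) (k : ℕ) :
    M.runFrom w c (k + 1) = (M.step w c).bind fun c' => M.runFrom w c' k := by
  induction k with
  | zero => simp [runFrom]
  | succ k ih =>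
    rw [runFrom, ih, PMF.bind_bind]
    rfl

theorem configAfter_eq_runFrom (k : ℕ) : M.configAfter w k = M.runFrom w (M.start, 0) k := by
  induction k with
  | zero => rfl
  | succ k ih => rw [configAfter, ih, runFrom]

theorem nonempty_of_ne_zero {X : Set Q} (h : (⨆ k, M.stateProb w k X) ≠ 0) :
    X.Nonempty := by
  by_contra hX
  apply h
  rw [Set.not_nonempty_iff_eq_empty.1 hX]
  simp [stateProb]

end

variable {A Q : Type*} [Fintype Q] (M : TwoPFA A Q) (τ : ℕ → TapeSymbol A) (m : ℕ)

/-- The expectation of `φ` at the configuration that follows the non-halting configuration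
`(q, i)` on the tape `τ` with right end-marker in cell `m + 1`. -/
def stepMean (q : Q) (i : ℕ) (φ : Q → ℕ → ℝ≥0∞) : ℝ≥0∞ :=
  ∑ p : Q × HeadMove, M.δ q (τ i) p * φ p.1 (moveNat m i p.2)

section stepMean

variable {M τ m} {q : Q} {i : ℕ} {φ ψ : Q → ℕ → ℝ≥0∞}

theorem stepMean_mono
    (h : ∀ q' d, φ q' (moveNat m i d) ≤ ψ q' (moveNat m i d)) :
    M.stepMean τ m q i φ ≤ M.stepMean τ m q i ψ :=
  Finset.sum_le_sum fun _ _ => mul_le_mul_right (h _ _) _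

theorem stepMean_congr
    (h : ∀ q' d, φ q' (moveNat m i d) = ψ q' (moveNat m i d)) :
    M.stepMean τ m q i φ = M.stepMean τ m q i ψ :=
  Finset.sum_congr rfl fun _ _ => by rw [h]

theorem stepMean_add : M.stepMean τ m q i (fun q' i' => φ q' i' + ψ q' i') =
    M.stepMean τ m q i φ + M.stepMean τ m q i ψ := by
  simp only [stepMean, mul_add, Finset.sum_add_distrib]

theorem stepMean_mul_const (c : ℝ≥0∞) :
    M.stepMean τ m q i (fun q' i' => φ q' i' * c) = M.stepMean τ m q i φ * c := by
  simp only [stepMean, Finset.sum_mul, mul_assoc]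

theorem stepMean_one : M.stepMean τ m q i (fun _ _ => 1) = 1 := by
  have h := (M.δ q (τ i)).tsum_coe
  rw [tsum_fintype] at h
  simpa only [stepMean, mul_one] using h

theorem stepMean_const (c : ℝ≥0∞) : M.stepMean τ m q i (fun _ _ => c) = c := by
  simpa [stepMean_one] using stepMean_mul_const (M := M) (τ := τ) (m := m) (q := q) (i := i)
    (φ := fun _ _ => 1) c

theorem stepMean_sum {ι : Type*} (s : Finset ι) (φ : ι → Q → ℕ → ℝ≥0∞) :
    M.stepMean τ m q i (fun q' i' => ∑ j ∈ s, φ j q' i') =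
      ∑ j ∈ s, M.stepMean τ m q i (φ j) := by
  simp only [stepMean, Finset.mul_sum]
  exact Finset.sum_comm

theorem stepMean_iSup {φ : ℕ → Q → ℕ → ℝ≥0∞} (h : ∀ q' i', Monotone fun t => φ t q' i') :
    M.stepMean τ m q i (fun q' i' => ⨆ t, φ t q' i') = ⨆ t, M.stepMean τ m q i (φ t) := by
  simp only [stepMean, ENNReal.mul_iSup]
  exact ENNReal.finsetSum_iSup_of_monotone fun p s t hst => mul_le_mul_right (h _ _ hst) _

end stepMean

open Classical in
/-- The probability that, starting at `(q, i)`, the state is in `X` after `t` steps. -/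
def stateValue (X : Set Q) : ℕ → Q → ℕ → ℝ≥0∞
  | 0, q, _ => if q ∈ X then 1 else 0
  | t + 1, q, i =>
    if q ∈ M.halting then (if q ∈ X then 1 else 0) else M.stepMean τ m q i (stateValue X t)

open Classical in
/-- The expected number of the first `t` steps that are taken before halting. -/
def timeValue : ℕ → Q → ℕ → ℝ≥0∞
  | 0, _, _ => 0
  | t + 1, q, i => if q ∈ M.halting then 0 else 1 + M.stepMean τ m q i (timeValue t)

open Classical in
/-- The expected number of times that the head moves between cells `c` and `c + 1` in the first
`t` steps. -/
def crossValue (c : ℕ) : ℕ → Q → ℕ → ℝ≥0∞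
  | 0, _, _ => 0
  | t + 1, q, i =>
    if q ∈ M.halting then 0 else
      M.stepMean τ m q i fun q' i' => (if i' ≤ c ↔ i ≤ c then 0 else 1) + crossValue c t q' i'

open Classical in
/-- The probability that, within `t` steps from `(q, i)`, the head moves between cells `c` and
`c + 1` and does so for the first time with new state `q'` (at `some q'`), or that the automaton
rejects before any such move (at `none`). -/
def exitValue (c : ℕ) : ℕ → Q → ℕ → Option Q → ℝ≥0∞
  -- Zero even at a rejecting state, where the value 1 appears from time 1 on; the supremum over
  -- time is unaffected.
  | 0, _, _, _ => 0
  | t + 1, q, i, o =>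
    if q ∈ M.rej then (if o = none then 1 else 0)
    else if q ∈ M.acc then 0
    else M.stepMean τ m q i fun q' i' =>
      if i' ≤ c ↔ i ≤ c then exitValue c t q' i' o else if o = some q' then 1 else 0

/-- The probability of leaving, as in `exitValue`, without a bound on time. -/
def exitProb (c : ℕ) (q : Q) (i : ℕ) (o : Option Q) : ℝ≥0∞ :=
  ⨆ t, M.exitValue τ m c t q i o

/-- The cell on the other side of the cut between `c` and `c + 1`. -/
def otherSide (c i : ℕ) : ℕ := if i ≤ c then c + 1 else c

/-- The probability that, starting at `(q, i)`, the automaton rejects after at most `k` head moves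
between cells `c` and `c + 1`. -/
def boundedReject (c : ℕ) : ℕ → Q → ℕ → ℝ≥0∞
  | 0, q, i => M.exitProb τ m c q i none
  | k + 1, q, i => M.exitProb τ m c q i none +
      ∑ q', M.exitProb τ m c q i (some q') * boundedReject c k q' (otherSide c i)

section values

variable {M τ m}

theorem otherSide_eq {c i : ℕ} {d : HeadMove} (h : ¬(moveNat m i d ≤ c ↔ i ≤ c)) :
    moveNat m i d = otherSide c i := by
  have h1 := moveNat_le m i d
  have h2 := le_moveNat m i d
  unfold otherSide
  split_ifs with h3
  · simp only [h3, iff_true] at h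
    omega
  · simp only [h3, iff_false, not_not] at h
    omega

theorem otherSide_congr {c i i' : ℕ} (h : i' ≤ c ↔ i ≤ c) : otherSide c i' = otherSide c i := by
  simp only [otherSide, h]

theorem stateValue_of_halting {X : Set Q} {q : Q} (hq : q ∈ M.halting) (t i : ℕ) :
    M.stateValue τ m X t q i = M.stateValue τ m X 0 q i := by
  cases t with
  | zero => rfl
  | succ t => simp [stateValue, hq]

theorem stateValue_zero_add_le_one {X Y : Set Q} (h : Disjoint X Y) (q : Q) (i : ℕ) :
    M.stateValue τ m X 0 q i + M.stateValue τ m Y 0 q i ≤ 1 := by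
  by_cases hX : q ∈ X
  · have hY := Set.disjoint_left.1 h hX
    simp [stateValue, hX, hY]
  · by_cases hY : q ∈ Y <;> simp [stateValue, hX, hY]

theorem stateValue_add_le_one {X Y : Set Q} (h : Disjoint X Y) (t : ℕ) (q : Q) (i : ℕ) :
    M.stateValue τ m X t q i + M.stateValue τ m Y t q i ≤ 1 := by
  induction t generalizing q i with
  | zero => exact stateValue_zero_add_le_one h q i
  | succ t ih =>
    by_cases hq : q ∈ M.halting
    · rw [stateValue_of_halting hq (t + 1), stateValue_of_halting hq (t + 1)]
      exact stateValue_zero_add_le_one h q i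
    · simp only [stateValue, hq, if_false, ← stepMean_add]
      exact (stepMean_mono fun q' d => ih q' _).trans_eq (stepMean_const 1)

theorem stateValue_le_one (X : Set Q) (t : ℕ) (q : Q) (i : ℕ) :
    M.stateValue τ m X t q i ≤ 1 :=
  le_self_add.trans (stateValue_add_le_one (Set.disjoint_empty X) t q i)

theorem stateValue_mono {X : Set Q} (hX : X ⊆ M.halting) (q : Q) (i : ℕ) :
    Monotone fun t => M.stateValue τ m X t q i := by
  refine monotone_nat_of_le_succ fun t => ?_
  induction t generalizing q i with
  | zero =>
    by_cases hq : q ∈ M.halting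
    · rw [stateValue_of_halting hq (0 + 1)]
    · have : q ∉ X := fun h => hq (hX h)
      simp [stateValue, this]
  | succ t ih =>
    by_cases hq : q ∈ M.halting
    · rw [stateValue_of_halting hq, stateValue_of_halting hq (t + 1 + 1)]
    · rw [stateValue, stateValue, if_neg hq, if_neg hq]
      exact stepMean_mono fun q' d => ih _ _

theorem timeValue_eq_sum (t : ℕ) (q : Q) (i : ℕ) :
    M.timeValue τ m t q i = ∑ k ∈ Finset.range t, M.stateValue τ m M.haltingᶜ k q i := by
  induction t generalizing q i with
  | zero => rfl
  | succ t ih =>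
    by_cases hq : q ∈ M.halting
    · simp [timeValue, hq, stateValue_of_halting, stateValue]
    · have hT : M.timeValue τ m t =
          fun q i => ∑ k ∈ Finset.range t, M.stateValue τ m M.haltingᶜ k q i := by
        ext q i; exact ih q i
      rw [timeValue, if_neg hq, hT, stepMean_sum, Finset.sum_range_succ', add_comm]
      simp [stateValue, hq]

/-- The head moves by at most one cell, so a step crosses at most one cut: the one just after the
smaller of its two positions. -/
theorem sum_crossValue_le (s : Finset ℕ) (t : ℕ) (q : Q) (i : ℕ) :
    ∑ c ∈ s, M.crossValue τ m c t q i ≤ M.timeValue τ m t q i := by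
  induction t generalizing q i with
  | zero => simp [crossValue, timeValue]
  | succ t ih =>
    by_cases hq : q ∈ M.halting
    · simp [crossValue, timeValue, hq]
    · simp only [crossValue, timeValue, hq, if_false, ← stepMean_sum]
      refine le_trans ?_ (add_le_add_left (stepMean_const (M := M) (τ := τ) (m := m) (q := q)
        (i := i) 1).le _)
      rw [← stepMean_add]
      refine stepMean_mono fun q' d => ?_
      rw [Finset.sum_add_distrib]
      refine add_le_add ?_ (ih _ _)
      have h1 := moveNat_le m i d
      have h2 := le_moveNat m i d
      calc ∑ c ∈ s, (if moveNat m i d ≤ c ↔ i ≤ c then (0 : ℝ≥0∞) else 1)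
          ≤ ∑ c ∈ s, if c = min i (moveNat m i d) then 1 else 0 := by
            refine Finset.sum_le_sum fun c _ => ?_
            by_cases h : moveNat m i d ≤ c ↔ i ≤ c
            · simp [h]
            · have : c = min i (moveNat m i d) := by omega
              rw [if_pos this, if_neg h]
        _ ≤ 1 := by
            rw [Finset.sum_ite_eq']
            split_ifs
            · exact le_rfl
            · exact zero_le_one

theorem exitValue_mono (c : ℕ) (q : Q) (i : ℕ) (o : Option Q) :
    Monotone fun t => M.exitValue τ m c t q i o := by
  refine monotone_nat_of_le_succ fun t => ?_
  induction t generalizing q i with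
  | zero => simp [exitValue]
  | succ t ih =>
    rw [exitValue, exitValue]
    split_ifs
    · exact le_rfl
    · exact le_rfl
    · exact le_rfl
    · refine stepMean_mono fun q' d => ?_
      split_ifs
      · exact ih _ _
      · exact le_rfl
      · exact le_rfl

theorem exitValue_le_one (c t : ℕ) (q : Q) (i : ℕ) (o : Option Q) :
    M.exitValue τ m c t q i o ≤ 1 := by
  induction t generalizing q i with
  | zero => simp [exitValue]
  | succ t ih =>
    rw [exitValue]
    split_ifs
    · exact le_rfl
    · exact zero_le_one
    · exact zero_le_one
    · refine (stepMean_mono fun q' d => ?_).trans_eq (stepMean_const 1)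
      split_ifs
      · exact ih _ _
      · exact le_rfl
      · exact zero_le_one

theorem exitProb_le_one (c : ℕ) (q : Q) (i : ℕ) (o : Option Q) : M.exitProb τ m c q i o ≤ 1 :=
  iSup_le fun t => exitValue_le_one c t q i o

/-- Until it leaves, the head reads only the side of the cut on which it started. -/
theorem exitValue_congr {τ' : ℕ → TapeSymbol A} {c i : ℕ}
    (h : ∀ j, (j ≤ c ↔ i ≤ c) → τ j = τ' j) (t : ℕ) (q : Q) (o : Option Q) :
    M.exitValue τ m c t q i o = M.exitValue τ' m c t q i o := by
  induction t generalizing q i with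
  | zero => rfl
  | succ t ih =>
    rw [exitValue, exitValue]
    have : ∀ φ, M.stepMean τ m q i φ = M.stepMean τ' m q i φ := fun φ => by
      rw [stepMean, stepMean, h i Iff.rfl]
    rw [this]
    congr 2
    refine stepMean_congr fun q' d => ?_
    by_cases hs : moveNat m i d ≤ c ↔ i ≤ c
    · rw [if_pos hs, if_pos hs]
      exact ih (fun j hj => h j (hj.trans hs)) q'
    · rw [if_neg hs, if_neg hs]

theorem exitProb_congr {τ' : ℕ → TapeSymbol A} {c i : ℕ}
    (h : ∀ j, (j ≤ c ↔ i ≤ c) → τ j = τ' j) (q : Q) (o : Option Q) :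
    M.exitProb τ m c q i o = M.exitProb τ' m c q i o := by
  simp only [exitProb, exitValue_congr h]

theorem exitProb_eq_iSup_succ (c : ℕ) (q : Q) (i : ℕ) (o : Option Q) :
    M.exitProb τ m c q i o = ⨆ t, M.exitValue τ m c (t + 1) q i o :=
  ((exitValue_mono c q i o).iSup_nat_add 1).symm

open Classical in
theorem exitProb_of_rej {q : Q} (hq : q ∈ M.rej) (c i : ℕ) (o : Option Q) :
    M.exitProb τ m c q i o = if o = none then 1 else 0 := by
  simp [exitProb_eq_iSup_succ, exitValue, hq]

open Classical in
theorem exitProb_of_notMem_halting {q : Q} (hq : q ∉ M.halting) (c i : ℕ) (o : Option Q) :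
    M.exitProb τ m c q i o = M.stepMean τ m q i fun q' i' =>
      if i' ≤ c ↔ i ≤ c then M.exitProb τ m c q' i' o else if o = some q' then 1 else 0 := by
  have h1 : q ∉ M.rej := fun h => hq (rej_subset_halting h)
  have h2 : q ∉ M.acc := fun h => hq (acc_subset_halting h)
  simp only [exitProb_eq_iSup_succ c q, exitValue, h1, h2, if_false]
  rw [← stepMean_iSup]
  · refine stepMean_congr fun q' d => ?_
    by_cases hs : moveNat m i d ≤ c ↔ i ≤ c
    · simp only [if_pos hs, exitProb]
    · simp only [if_neg hs, iSup_const]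
  · intro q' i' s t hst
    by_cases hs : i' ≤ c ↔ i ≤ c
    · simpa only [if_pos hs] using exitValue_mono c q' i' o hst
    · simp only [if_neg hs, le_refl]

theorem boundedReject_of_rej {q : Q} (hq : q ∈ M.rej) (c k i : ℕ) :
    M.boundedReject τ m c k q i = 1 := by
  cases k <;> simp [boundedReject, exitProb_of_rej hq]

theorem boundedReject_zero_of_notMem_halting {q : Q} (hq : q ∉ M.halting) (c i : ℕ) :
    M.boundedReject τ m c 0 q i = M.stepMean τ m q i fun q' i' =>
      if i' ≤ c ↔ i ≤ c then M.boundedReject τ m c 0 q' i' else 0 := by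
  simp [boundedReject, exitProb_of_notMem_halting hq]

theorem boundedReject_succ_of_notMem_halting {q : Q} (hq : q ∉ M.halting) (c k i : ℕ) :
    M.boundedReject τ m c (k + 1) q i = M.stepMean τ m q i fun q' i' =>
      if i' ≤ c ↔ i ≤ c then M.boundedReject τ m c (k + 1) q' i'
      else M.boundedReject τ m c k q' i' := by
  simp only [boundedReject, exitProb_of_notMem_halting hq, ← stepMean_mul_const, ← stepMean_sum,
    ← stepMean_add]
  refine stepMean_congr fun q' d => ?_
  by_cases hs : moveNat m i d ≤ c ↔ i ≤ c
  · simp only [if_pos hs, otherSide_congr hs]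
  · simp only [if_neg hs]
    rw [otherSide_eq hs, Finset.sum_eq_single q' (fun x _ hx => by simp [hx]) (by simp)]
    simp

/-- Rejection needs more than `k` crossings with probability at most the expected number of
crossings divided by `k + 1`. -/
theorem stateValue_rej_le (c t k : ℕ) (q : Q) (i : ℕ) :
    M.stateValue τ m M.rej t q i ≤
      M.boundedReject τ m c k q i + M.crossValue τ m c t q i * (k + 1 : ℝ≥0∞)⁻¹ := by
  induction t generalizing k q i with
  | zero =>
    by_cases hq : q ∈ M.rej
    · simp [stateValue, hq, boundedReject_of_rej hq]
    · simp [stateValue, hq]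
  | succ t ih =>
    by_cases hr : q ∈ M.rej
    · rw [boundedReject_of_rej hr]
      exact (stateValue_le_one _ _ _ _).trans le_self_add
    by_cases hq : q ∈ M.halting
    · simp [stateValue, hr, hq]
    rw [stateValue, if_neg hq, crossValue, if_neg hq, ← stepMean_mul_const]
    cases k with
    | zero =>
      rw [boundedReject_zero_of_notMem_halting hq, ← stepMean_add]
      refine stepMean_mono fun q' d => ?_
      by_cases hs : moveNat m i d ≤ c ↔ i ≤ c
      · simpa only [if_pos hs, zero_add] using ih 0 q' (moveNat m i d)
      · simp only [if_neg hs, Nat.cast_zero, zero_add, inv_one, mul_one]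
        exact (stateValue_le_one _ _ _ _).trans le_self_add
    | succ k =>
      rw [boundedReject_succ_of_notMem_halting hq, ← stepMean_add]
      refine stepMean_mono fun q' d => ?_
      by_cases hs : moveNat m i d ≤ c ↔ i ≤ c
      · simpa only [if_pos hs, zero_add] using ih (k + 1) q' (moveNat m i d)
      · simp only [if_neg hs]
        set X := M.crossValue τ m c t q' (moveNat m i d)
        -- The crossing uses up one of k + 1 allowed ones, so X/(k + 1) has to be compared with (1 +
        -- X)/(k + 2). The former is the smaller exactly when X ≤ k + 1; otherwise the latter is at
        -- least 1.
        by_cases hX : X ≤ k + 1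
        · refine (ih k q' (moveNat m i d)).trans (add_le_add le_rfl ?_)
          rw [← div_eq_mul_inv, ← div_eq_mul_inv, ENNReal.le_div_iff_mul_le (by simp) (by simp)]
          calc X / (k + 1) * (((k + 1 : ℕ) : ℝ≥0∞) + 1)
              = X / (k + 1) * (k + 1) + X / (k + 1) := by push_cast; ring
            _ ≤ X + 1 := by
              gcongr
              · exact (ENNReal.div_mul_cancel (by simp) (by simp)).le
              · exact ENNReal.div_le_of_le_mul (by simpa using hX)
            _ = 1 + X := add_comm _ _
        · refine (stateValue_le_one _ _ _ _).trans (le_add_left ?_)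
          rw [← div_eq_mul_inv, ENNReal.le_div_iff_mul_le (by simp) (by simp), one_mul, add_comm]
          push_cast
          exact add_le_add le_rfl (not_le.1 hX).le

theorem iSup_stateValue_of_notMem_halting {X : Set Q} (hX : X ⊆ M.halting) {q : Q}
    (hq : q ∉ M.halting) (i : ℕ) :
    M.stepMean τ m q i (fun q' i' => ⨆ t, M.stateValue τ m X t q' i') =
      ⨆ t, M.stateValue τ m X t q i := by
  rw [stepMean_iSup (fun q' i' => stateValue_mono hX q' i'),
    ← (stateValue_mono hX q i).iSup_nat_add 1]
  simp [stateValue, hq]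

/-- Whatever follows the first crossing is replaced by an underestimate u of the rejection
probability there; iterating this bounds `boundedReject`. -/
theorem exitValue_le_iSup_stateValue {c : ℕ} {u : Q → ℝ≥0∞} {i : ℕ}
    (hu : ∀ q, u q ≤ ⨆ t, M.stateValue τ m M.rej t q (otherSide c i)) (t : ℕ) (q : Q) :
    M.exitValue τ m c t q i none + ∑ q', M.exitValue τ m c t q i (some q') * u q' ≤
      ⨆ t, M.stateValue τ m M.rej t q i := by
  induction t generalizing q i with
  | zero => simp [exitValue]
  | succ t ih =>
    by_cases hr : q ∈ M.rej
    · refine le_iSup_of_le 0 ?_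
      simp [exitValue, stateValue, hr]
    by_cases ha : q ∈ M.acc
    · simp [exitValue, hr, ha]
    have hq : q ∉ M.halting := fun h => h.elim ha hr
    simp only [exitValue, hr, ha, if_false, ← stepMean_mul_const, ← stepMean_sum, ← stepMean_add]
    rw [← iSup_stateValue_of_notMem_halting rej_subset_halting hq]
    refine stepMean_mono fun q' d => ?_
    by_cases hs : moveNat m i d ≤ c ↔ i ≤ c
    · simp only [if_pos hs]
      exact ih (by rwa [otherSide_congr hs]) q'
    · simp only [if_neg hs]
      rw [otherSide_eq hs, Finset.sum_eq_single q' (fun x _ hx => by simp [hx]) (by simp)]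
      simpa using hu q'

theorem boundedReject_le (c k : ℕ) (q : Q) (i : ℕ) :
    M.boundedReject τ m c k q i ≤ ⨆ t, M.stateValue τ m M.rej t q i := by
  have key : ∀ (u : Q → ℝ≥0∞) (q : Q) (i : ℕ),
      (∀ q, u q ≤ ⨆ t, M.stateValue τ m M.rej t q (otherSide c i)) →
      M.exitProb τ m c q i none + ∑ q', M.exitProb τ m c q i (some q') * u q' ≤
        ⨆ t, M.stateValue τ m M.rej t q i := by
    intro u q i hu
    have hm : ∀ q', Monotone fun t => M.exitValue τ m c t q i (some q') * u q' :=
      fun q' s t hst => mul_le_mul_left (exitValue_mono c q i (some q') hst) _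
    simp only [exitProb, ENNReal.iSup_mul]
    rw [ENNReal.finsetSum_iSup_of_monotone hm, ENNReal.iSup_add_iSup_of_monotone
      (exitValue_mono c q i none) fun s t hst => Finset.sum_le_sum fun q' _ => hm q' hst]
    exact iSup_le fun t => exitValue_le_iSup_stateValue hu t q
  induction k generalizing q i with
  | zero => simpa [boundedReject] using key (fun _ => 0) q i (by simp)
  | succ k ih => exact key _ q i fun q' => ih q' _

theorem boundedReject_le_one (c k : ℕ) (q : Q) (i : ℕ) : M.boundedReject τ m c k q i ≤ 1 :=
  (boundedReject_le c k q i).trans (iSup_le fun t => stateValue_le_one _ t q i)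

end values

/-! ### From the recursions to acceptance, rejection and expected time -/

section run

variable (w : List A)

theorem runFrom_toOuterMeasure (X : Set Q) (k : ℕ) (c : Q × Fin (w.length + 2)) :
    (M.runFrom w c k).toOuterMeasure {c | c.1 ∈ X} =
      M.stateValue (tapeSymbolNat w) w.length X k c.1 c.2.val := by
  classical
  induction k generalizing c with
  | zero =>
    rw [runFrom, PMF.toOuterMeasure_pure_apply]
    simp [stateValue]
  | succ k ih =>
    rw [runFrom_succ, step]
    split_ifs with hc
    · rw [PMF.pure_bind, ih, stateValue_of_halting hc, stateValue_of_halting hc (k + 1)]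
    · rw [PMF.bind_map, PMF.toOuterMeasure_bind_apply, tsum_fintype, stateValue, if_neg hc,
        stepMean]
      refine Finset.sum_congr rfl fun p _ => ?_
      simp only [Function.comp, ih, moveHead_val]
      rfl

theorem stateProb_eq (X : Set Q) (k : ℕ) :
    M.stateProb w k X = M.stateValue (tapeSymbolNat w) w.length X k M.start 0 := by
  rw [stateProb, configAfter_eq_runFrom, runFrom_toOuterMeasure]
  rfl

theorem timeValue_le_expectedTime (t : ℕ) :
    M.timeValue (tapeSymbolNat w) w.length t M.start 0 ≤ M.expectedTime w := by
  simp only [timeValue_eq_sum, expectedTime, stateProb_eq]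
  exact ENNReal.sum_le_tsum _

theorem acceptProb_add_rejectProb_le_one : M.acceptProb w + M.rejectProb w ≤ 1 := by
  simp only [acceptProb, rejectProb, stateProb_eq]
  rw [ENNReal.iSup_add_iSup_of_monotone (stateValue_mono acc_subset_halting _ _)
    (stateValue_mono rej_subset_halting _ _)]
  exact iSup_le fun t => stateValue_add_le_one M.disjoint_acc_rej t _ _

theorem start_notMem_of_ne_zero {X : Set Q} (w : List A)
    (h : (⨆ k, M.stateProb w k X) ≠ 0) (Y : Set Q) (hY : Y ⊆ M.halting) (hXY : Disjoint X Y) :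
    M.start ∉ Y := by
  intro hs
  apply h
  have : M.start ∉ X := Set.disjoint_right.1 hXY hs
  simp [stateProb_eq, stateValue_of_halting (hY hs), stateValue, this]

theorem one_le_expectedTime (h : M.start ∉ M.halting) : 1 ≤ M.expectedTime w := by
  refine le_trans ?_ (M.timeValue_le_expectedTime w 1)
  simp [timeValue, h]

end run

end TwoPFA

end

/-! ### The iterated function on strings with at most one 1, and padded words -/

theorem NEiter_eq_false : ∀ (d : ℕ) {z : Fin (3 ^ d) → Bool}, (∀ i, z i = false) →
    NEiter d z = false
  | 0, _, h => h _
  | d + 1, z, h => by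
    simp only [NEiter]
    rw [NEiter_eq_false d fun i => h _, NEiter_eq_false d fun i => h _,
      NEiter_eq_false d fun i => h _]
    rfl

theorem NEiter_eq_true : ∀ (d : ℕ) {z : Fin (3 ^ d) → Bool} (i : Fin (3 ^ d)), z i = true →
    (∀ j, j ≠ i → z j = false) → NEiter d z = true
  | 0, z, i, hi, _ => by
    have : i = ⟨0, by norm_num⟩ := Subsingleton.elim (α := Fin 1) _ _
    rwa [this] at hi
  | d + 1, z, i, hi, h => by
    have hlt : i.val < 3 ^ d * 3 := pow_succ 3 d ▸ i.isLt
    have hf : ∀ p : Fin (3 ^ d) → Fin (3 ^ (d + 1)), (∀ j, (p j).val ≠ i.val) →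
        NEiter d (fun j => z (p j)) = false := fun p hp =>
      NEiter_eq_false d fun j => h _ fun e => hp j (congrArg Fin.val e)
    have ht : ∀ (p : Fin (3 ^ d) → Fin (3 ^ (d + 1))) (j₀ : Fin (3 ^ d)),
        (∀ j, (p j).val = i.val ↔ j.val = j₀.val) → NEiter d (fun j => z (p j)) = true :=
      fun p j₀ hp => NEiter_eq_true d j₀ (Fin.ext ((hp j₀).2 rfl) ▸ hi) fun j hj =>
        h _ fun e => hj (Fin.ext ((hp j).1 (congrArg Fin.val e)))
    -- Exactly one of the three blocks contains i, so `NE` sees exactly one true argument. Only the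
    -- values of the block embeddings matter.
    have key : ∀ p₀ p₁ p₂ : Fin (3 ^ d) → Fin (3 ^ (d + 1)), (∀ j, (p₀ j).val = j) →
        (∀ j, (p₁ j).val = 3 ^ d + j) → (∀ j, (p₂ j).val = 2 * 3 ^ d + j) →
        NE (NEiter d fun j => z (p₀ j)) (NEiter d fun j => z (p₁ j))
          (NEiter d fun j => z (p₂ j)) = true := by
      intro p₀ p₁ p₂ h₀ h₁ h₂
      by_cases hi₁ : i.val < 3 ^ d
      · rw [ht p₀ ⟨i.val, hi₁⟩ (fun j => by rw [h₀]), hf p₁ (fun j => by rw [h₁]; omega),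
          hf p₂ (fun j => by rw [h₂]; omega)]
        rfl
      by_cases hi₂ : i.val < 2 * 3 ^ d
      · rw [hf p₀ (fun j => by rw [h₀]; omega),
          ht p₁ ⟨i.val - 3 ^ d, by omega⟩ (fun j => by rw [h₁]; dsimp only; omega),
          hf p₂ (fun j => by rw [h₂]; omega)]
        rfl
      · rw [hf p₀ (fun j => by rw [h₀]; omega), hf p₁ (fun j => by rw [h₁]; omega),
          ht p₂ ⟨i.val - 2 * 3 ^ d, by omega⟩ (fun j => by rw [h₂]; dsimp only; omega)]
        rfl
    exact key _ _ _ (fun _ => rfl) (fun _ => rfl) fun _ => rfl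

theorem paddedWord_length {n : ℕ} (x y : Fin n → Bool) : (paddedWord x y).length = 3 * n := by
  simp only [paddedWord, List.length_append, List.length_ofFn, List.length_replicate]
  ring

theorem paddedWord_injective {n : ℕ} {x y x' y' : Fin n → Bool}
    (h : paddedWord x y = paddedWord x' y') : x = x' ∧ y = y' := by
  unfold paddedWord at h
  have h1 := List.append_inj h (by simp)
  have h2 := List.append_inj h1.1 (by simp)
  constructor
  · ext i
    have := congrFun (List.ofFn_injective h2.1) i
    simp only [InputSymbol.bit.injEq] at this
    rw [this]
  · ext i
    have := congrFun (List.ofFn_injective h1.2) i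
    simp only [InputSymbol.bit.injEq] at this
    rw [this]

theorem paddedWord_mem_LNE {d : ℕ} (x y : Fin (3 ^ d) → Bool) :
    paddedWord x y ∈ LNE d ↔ RNE d x y = true := by
  constructor
  · rintro ⟨x', y', h, e⟩
    obtain ⟨rfl, rfl⟩ := paddedWord_injective e
    exact h
  · exact fun h => ⟨x, y, h, rfl⟩

/-- Cells up to 2n hold the left end-marker, x and the padding. With the mirror statement for cells
beyond n, every cut in the padding separates x from y. -/
theorem tapeSymbolNat_paddedWord_left {n j : ℕ} (hj : j ≤ 2 * n) (x y y' : Fin n → Bool) :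
    tapeSymbolNat (paddedWord x y) j = tapeSymbolNat (paddedWord x y') j := by
  cases j with
  | zero => rfl
  | succ j =>
    simp only [tapeSymbolNat, paddedWord]
    have hlen : j < ((List.ofFn fun i => InputSymbol.bit (x i)) ++
        List.replicate n InputSymbol.hash).length := by simp; omega
    rw [List.getElem?_append_left hlen, List.getElem?_append_left hlen]

theorem tapeSymbolNat_paddedWord_right {n j : ℕ} (hj : n < j) (x x' y : Fin n → Bool) :
    tapeSymbolNat (paddedWord x y) j = tapeSymbolNat (paddedWord x' y) j := by
  cases j with
  | zero => omega
  | succ j =>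
    simp only [tapeSymbolNat, paddedWord, List.append_assoc]
    have hlen : ∀ x : Fin n → Bool, (List.ofFn fun i => InputSymbol.bit (x i)).length ≤ j :=
      fun x => by simp; omega
    rw [List.getElem?_append_right (hlen x), List.getElem?_append_right (hlen x')]
    simp only [List.length_ofFn]

/-! ### Counting crossing sequences and the tradeoff -/

/-- The number of sequences of length at most `k` over an alphabet of `N` letters. -/
def sequenceCount (N : ℕ) : ℕ → ℕ
  | 0 => 1
  | k + 1 => 1 + N * sequenceCount N k

/-- The extra 1 carries the induction: N (s + 1) ≥ (1 + N s) + 1 because N ≥ 2. -/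
theorem sequenceCount_lt {N : ℕ} (hN : 2 ≤ N) : ∀ k, sequenceCount N k + 1 ≤ 2 * N ^ k
  | 0 => by simp [sequenceCount]
  | k + 1 => by
    have h := Nat.mul_le_mul_left N (sequenceCount_lt hN k)
    rw [sequenceCount, pow_succ]
    linarith

namespace TwoPFA

variable {Q : Type*} [Fintype Q] (M : TwoPFA InputSymbol Q)

/-- The exit probability is a function of x alone or of y alone, according to the side of the cut
that contains i. -/
theorem corruptionBound_exitProb_mul {n m c : ℕ} (hc : n ≤ c) (hc' : c ≤ 2 * n) (q : Q) (i : ℕ)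
    (o : Option Q) {R : ℝ} {N : (Fin n → Bool) → (Fin n → Bool) → ℝ}
    (h : CorruptionBound n R N) :
    CorruptionBound n R fun x y =>
      (M.exitProb (tapeSymbolNat (paddedWord x y)) m c q i o).toReal * N x y := by
  have hle : ∀ x y : Fin n → Bool,
      (M.exitProb (tapeSymbolNat (paddedWord x y)) m c q i o).toReal ≤ 1 := fun x y =>
    ENNReal.toReal_le_of_le_ofReal zero_le_one (by simpa using exitProb_le_one c q i o)
  by_cases hi : i ≤ c
  · have e : ∀ x y : Fin n → Bool, M.exitProb (tapeSymbolNat (paddedWord x y)) m c q i o =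
        M.exitProb (tapeSymbolNat (paddedWord x fun _ => false)) m c q i o := fun x y =>
      exitProb_congr (fun j hj =>
        tapeSymbolNat_paddedWord_left ((hj.2 hi).trans hc') x y _) q o
    simp only [e]
    exact h.mul_left (fun _ => ENNReal.toReal_nonneg) fun x => hle x _
  · have e : ∀ x y : Fin n → Bool, M.exitProb (tapeSymbolNat (paddedWord x y)) m c q i o =
        M.exitProb (tapeSymbolNat (paddedWord (fun _ => false) y)) m c q i o := fun x y =>
      exitProb_congr (fun j hj => tapeSymbolNat_paddedWord_right
        (hc.trans_lt (not_le.1 fun h => hi (hj.1 h))) x _ y) q o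
    simp only [e]
    exact h.mul_right (fun _ => ENNReal.toReal_nonneg) fun y => hle _ y

/-- Splitting at the first crossing gives one term without a crossing and one for each state entered
by it, which is the recursion of `sequenceCount`. -/
theorem corruptionBound_boundedReject {n m c : ℕ} (hc : n ≤ c) (hc' : c ≤ 2 * n) (k : ℕ) (q : Q)
    (i : ℕ) :
    CorruptionBound n (sequenceCount (Fintype.card Q) k) fun x y =>
      (M.boundedReject (tapeSymbolNat (paddedWord x y)) m c k q i).toReal := by
  have h0 : ∀ i, CorruptionBound n 1 fun x y =>
      (M.exitProb (tapeSymbolNat (paddedWord x y)) m c q i none).toReal := fun i => by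
    simpa using M.corruptionBound_exitProb_mul (m := m) hc hc' q i none CorruptionBound.one
  induction k generalizing q i with
  | zero => simpa [boundedReject, sequenceCount] using h0 i
  | succ k ih =>
    have hE : ∀ τ o, M.exitProb τ m c q i o ≠ ∞ := fun τ o =>
      ne_top_of_le_ne_top ENNReal.one_ne_top (exitProb_le_one c q i o)
    have hV : ∀ τ q', M.boundedReject τ m c k q' (otherSide c i) ≠ ∞ := fun τ q' =>
      ne_top_of_le_ne_top ENNReal.one_ne_top (boundedReject_le_one c k q' _)
    have e : ∀ τ, (M.boundedReject τ m c (k + 1) q i).toReal =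
        (M.exitProb τ m c q i none).toReal + ∑ q', (M.exitProb τ m c q i (some q')).toReal *
          (M.boundedReject τ m c k q' (otherSide c i)).toReal := fun τ => by
      rw [boundedReject, ENNReal.toReal_add (hE τ none)
        (ENNReal.sum_ne_top.2 fun q' _ => ENNReal.mul_ne_top (hE τ _) (hV τ q')),
        ENNReal.toReal_sum fun q' _ => ENNReal.mul_ne_top (hE τ _) (hV τ q')]
      simp only [ENNReal.toReal_mul]
    simp only [e]
    have h1 := (h0 i).add (CorruptionBound.sum Finset.univ fun q' =>
      M.corruptionBound_exitProb_mul (m := m) hc hc' q i (some q') (ih q' (otherSide c i)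
        fun i => by
          simpa using M.corruptionBound_exitProb_mul (m := m) hc hc' q' i none CorruptionBound.one))
    convert h1 using 1
    simp [sequenceCount]

/-- An automaton that rejects disjoint pairs and accepts uniquely intersecting pairs in time `T`
gives a lower bound on the number of crossing sequences of length at most `k`, for `k` large
compared with `T / n`. -/
theorem le_sequenceCount_mul_exp {n : ℕ} (hn : 0 < n)
    (hdisj : ∀ x y : Fin n → Bool, (∀ i, (x i && y i) = false) →
      2 / 3 < M.rejectProb (paddedWord x y))
    (hmeet : ∀ x y : Fin n → Bool, MeetOnce x y → 2 / 3 ≤ M.acceptProb (paddedWord x y))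
    {T : ℝ≥0} (hT : ∀ x y : Fin n → Bool, M.expectedTime (paddedWord x y) ≤ T) {k : ℕ}
    (hk : (T : ℝ) / (k + 1) ≤ n / 15) :
    (n : ℝ) / 24 ≤
      sequenceCount (Fintype.card Q) k * (56 * Real.exp (-(n / 448 : ℝ))) := by
  set F : ℕ → (Fin n → Bool) → (Fin n → Bool) → ℝ := fun c x y =>
    (M.boundedReject (tapeSymbolNat (paddedWord x y)) (3 * n) c k M.start 0).toReal with hF
  set s := Finset.Ico n (2 * n) with hs
  have hcard : s.card = n := by simp [hs]; omega
  -- Each of the n cuts contributes 2/3, and the Markov losses total at most T/(k + 1) ≤ n/15.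
  have hsum : ∀ x y : Fin n → Bool, (∀ i, (x i && y i) = false) →
      (n : ℝ) * (3 / 5) ≤ ∑ c ∈ s, F c x y := by
    intro x y hxy
    have h := hdisj x y hxy
    have hT' := hT x y
    simp only [rejectProb, stateProb_eq] at h
    obtain ⟨t, ht⟩ := lt_iSup_iff.1 h
    have hcross := (sum_crossValue_le (M := M) (τ := tapeSymbolNat (paddedWord x y))
      (m := (paddedWord x y).length) s t M.start 0).trans
      ((M.timeValue_le_expectedTime (paddedWord x y) t).trans hT')
    rw [paddedWord_length] at ht hcross
    have h1 : ∑ c ∈ s, (2 / 3 : ℝ≥0∞) ≤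
        ∑ c ∈ s, M.boundedReject (tapeSymbolNat (paddedWord x y)) (3 * n) c k M.start 0 +
          T * (k + 1 : ℝ≥0∞)⁻¹ := by
      refine le_trans ?_ (add_le_add_right (mul_le_mul_left hcross _) _)
      rw [Finset.sum_mul, ← Finset.sum_add_distrib]
      exact Finset.sum_le_sum fun c _ => ht.le.trans (stateValue_rej_le c t k _ _)
    have hV : ∀ c ∈ s, M.boundedReject (tapeSymbolNat (paddedWord x y)) (3 * n) c k M.start 0
        ≠ ∞ := fun c _ => ne_top_of_le_ne_top ENNReal.one_ne_top (boundedReject_le_one c k _ _)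
    have hTk : (T : ℝ≥0∞) * (k + 1 : ℝ≥0∞)⁻¹ ≠ ∞ :=
      ENNReal.mul_ne_top ENNReal.coe_ne_top (by simp)
    have h2 := ENNReal.toReal_mono (ENNReal.add_ne_top.2 ⟨ENNReal.sum_ne_top.2 hV, hTk⟩) h1
    have e1 : ((k : ℝ≥0∞) + 1).toReal = k + 1 := by
      exact_mod_cast ENNReal.toReal_natCast (k + 1)
    rw [ENNReal.toReal_add (ENNReal.sum_ne_top.2 hV) hTk, ENNReal.toReal_sum hV,
      Finset.sum_const, hcard, ENNReal.toReal_mul, ENNReal.toReal_inv, e1, ENNReal.coe_toReal,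
      ← div_eq_mul_inv] at h2
    simp only [nsmul_eq_mul, ENNReal.toReal_mul, ENNReal.toReal_natCast, ENNReal.toReal_div,
      ENNReal.toReal_ofNat] at h2
    simp only [hF]
    linarith only [h2, hk]
  have havg : (n : ℝ) * (3 / 5) ≤ ∑ c ∈ s, disjAvg n (F c) := by
    rw [← disjAvg_sum, ← disjAvg_const n ((n : ℝ) * (3 / 5))]
    exact disjAvg_mono_of_disjoint n hsum
  have hhit : ∀ c, hitSum n (F c) ≤ n * (1 / 3) := by
    intro c
    refine hitSum_le n fun x y hxy => ?_
    have h1 : M.boundedReject (tapeSymbolNat (paddedWord x y)) (3 * n) c k M.start 0 ≤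
        M.rejectProb (paddedWord x y) := by
      simp only [rejectProb, stateProb_eq, paddedWord_length]
      exact boundedReject_le c k _ _
    have h2 := (add_le_add (hmeet x y hxy) h1).trans (M.acceptProb_add_rejectProb_le_one _)
    have h3 := ENNReal.toReal_mono ENNReal.one_ne_top h2
    rw [ENNReal.toReal_add (by simp [ENNReal.div_eq_top])
      (ne_top_of_le_ne_top ENNReal.one_ne_top (boundedReject_le_one c k _ _))] at h3
    simp only [ENNReal.toReal_div, ENNReal.toReal_ofNat, ENNReal.toReal_one] at h3
    simp only [hF]
    linarith only [h3]
  -- Summed over the cuts and divided by n, the left side is at least (5/8)(3/5) n = 3n/8, and 3/8 -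
  -- 1/3 = 1/24.
  have hcut : ∑ c ∈ s, 5 / 8 * n * disjAvg n (F c) ≤ ∑ _c ∈ s, ((n : ℝ) * (1 / 3) +
      sequenceCount (Fintype.card Q) k * (56 * Real.exp (-(n / 448 : ℝ)))) := by
    refine Finset.sum_le_sum fun c hc => ?_
    rw [hs, Finset.mem_Ico] at hc
    exact ((M.corruptionBound_boundedReject hc.1 hc.2.le k M.start 0).apply).trans
      (add_le_add (hhit c) le_rfl)
  rw [← Finset.mul_sum, Finset.sum_const, hcard, nsmul_eq_mul] at hcut
  have hn' : (0 : ℝ) < n := Nat.cast_pos.2 hn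
  have h1 := mul_le_mul_of_nonneg_left havg hn'.le
  refine le_of_mul_le_mul_left ?_ hn'
  linarith

theorem space_eq : M.space * Real.log 2 = Real.log (Fintype.card Q) := by
  rw [space, Real.logb, div_mul_cancel₀ _ (Real.log_pos one_lt_two).ne']

/-- The time-space tradeoff for automata that separate disjoint from uniquely intersecting pairs. -/
theorem sq_le_mul_time_mul_space {n : ℕ} (hn : 0 < n)
    (hdisj : ∀ x y : Fin n → Bool, (∀ i, (x i && y i) = false) →
      2 / 3 < M.rejectProb (paddedWord x y))
    (hmeet : ∀ x y : Fin n → Bool, MeetOnce x y → 2 / 3 ≤ M.acceptProb (paddedWord x y))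
    {T : ℝ≥0} (hT : ∀ x y : Fin n → Bool, M.expectedTime (paddedWord x y) ≤ T) :
    (n : ℝ) ^ 2 ≤ 10 ^ 9 * (T * M.space) := by
  have hn' : (1 : ℝ) ≤ n := Nat.one_le_cast.2 hn
  have hrej : M.rejectProb (paddedWord (n := n) (fun _ => false) fun _ => false) ≠ 0 :=
    (pos_of_gt (hdisj _ _ (by simp))).ne'
  have hacc : M.acceptProb (paddedWord (n := n) (fun i => decide (i.val = 0))
      fun i => decide (i.val = 0)) ≠ 0 := by
    have h := hmeet (fun i => decide (i.val = 0)) (fun i => decide (i.val = 0))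
      ⟨⟨0, hn⟩, by simp, fun j hj => by simpa [Fin.ext_iff] using hj⟩
    exact (lt_of_lt_of_le (ENNReal.div_pos (by simp) (by simp)) h).ne'
  -- Some word is rejected and some word is accepted with positive probability, so the automaton
  -- cannot start halted. This gives T ≥ 1 and |Q| ≥ 2, hence S ≥ 1.
  have hstart : M.start ∉ M.halting := by
    rintro (h | h)
    · exact M.start_notMem_of_ne_zero _ hrej M.acc acc_subset_halting M.disjoint_acc_rej.symm h
    · exact M.start_notMem_of_ne_zero _ hacc M.rej rej_subset_halting M.disjoint_acc_rej h
  have hQ : 2 ≤ Fintype.card Q := by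
    obtain ⟨q, hq⟩ := M.nonempty_of_ne_zero _ hacc
    exact Fintype.one_lt_card_iff.2 ⟨M.start, q, fun h => hstart (h ▸ acc_subset_halting hq)⟩
  have hQ' : (2 : ℝ) ≤ Fintype.card Q := by exact_mod_cast hQ
  have hS : 1 ≤ M.space := by
    rw [space, Real.le_logb_iff_rpow_le one_lt_two (by linarith), Real.rpow_one]
    exact hQ'
  have hT1 : (1 : ℝ) ≤ T := by
    have h := (M.one_le_expectedTime (paddedWord (n := n) (fun _ => false) fun _ => false)
      hstart).trans (hT _ _)
    exact_mod_cast h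
  -- 10752 = 12 · 896, so for larger n the term 12 log 2 arising below is at most n/896, half of
  -- n/448. For smaller n, T S ≥ 1 suffices, since 10752² < 10⁹.
  by_cases hsmall : n < 10752
  · have h1 : (n : ℝ) < 10752 := by exact_mod_cast hsmall
    have h2 : (1 : ℝ) ≤ T * M.space := one_le_mul_of_one_le_of_one_le hT1 hS
    nlinarith
  have hlarge : (10752 : ℝ) ≤ n := by exact_mod_cast not_lt.1 hsmall
  -- This choice makes k + 1 exceed 15T/n, as the Markov step needs, while k is still at most 15T/n.
  set k := ⌊15 * (T : ℝ) / n⌋₊ with hkdef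
  have hk1 : (k : ℝ) ≤ 15 * T / n := Nat.floor_le (by positivity)
  have hk2 : 15 * (T : ℝ) / n < k + 1 := Nat.lt_floor_add_one _
  have hcount := M.le_sequenceCount_mul_exp hn hdisj hmeet hT (k := k) (by
    rw [div_lt_iff₀ (by linarith)] at hk2
    rw [div_le_iff₀ (by positivity)]
    linarith)
  have hcount' : (sequenceCount (Fintype.card Q) k : ℝ) ≤ 2 * (Fintype.card Q : ℝ) ^ k := by
    exact_mod_cast (Nat.le_succ _).trans (sequenceCount_lt hQ k)
  -- The constant is 24 · 112 = 2688 ≤ 2¹², after discarding the factor n ≥ 1.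
  have hexp : Real.exp (n / 448) ≤ 2 ^ 12 * (Fintype.card Q : ℝ) ^ k := by
    have h1 := hcount.trans (mul_le_mul_of_nonneg_right hcount' (by positivity))
    have h2 := mul_le_mul_of_nonneg_right h1 (Real.exp_pos (n / 448)).le
    have h3 : Real.exp (-(n / 448 : ℝ)) * Real.exp (n / 448) = 1 := by
      rw [← Real.exp_add]; simp
    have h4 : 2 * (Fintype.card Q : ℝ) ^ k * (56 * Real.exp (-(n / 448 : ℝ))) *
        Real.exp (n / 448) = 112 * (Fintype.card Q : ℝ) ^ k := by
      linear_combination (112 * (Fintype.card Q : ℝ) ^ k) * h3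
    rw [h4] at h2
    have h5 : (0 : ℝ) ≤ (Fintype.card Q : ℝ) ^ k := by positivity
    have h6 := mul_le_mul_of_nonneg_right hn' (Real.exp_pos ((n : ℝ) / 448)).le
    linarith
  have hlog := Real.log_le_log (Real.exp_pos _) hexp
  rw [Real.log_exp, Real.log_mul (by positivity) (by positivity), Real.log_pow, Real.log_pow,
    ← space_eq] at hlog
  have hl2 : Real.log 2 ≤ 1 := by linarith [Real.log_two_lt_d9]
  have h1 : (k : ℝ) * (M.space * Real.log 2) ≤ 15 * T / n * M.space := by
    refine mul_le_mul hk1 ?_ (mul_nonneg (by linarith) (Real.log_pos one_lt_two).le)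
      (by positivity)
    nlinarith
  have h2 : (n : ℝ) / 896 ≤ 15 * T / n * M.space := by
    push_cast at hlog
    linarith only [hlog, h1, hl2, hlarge]
  have h3 : 15 * (T : ℝ) / n * M.space * n = 15 * (T * M.space) := by
    field_simp
  have h4 := mul_le_mul_of_nonneg_right h2 (by linarith : (0 : ℝ) ≤ n)
  rw [h3] at h4
  have h5 : (0 : ℝ) ≤ T * M.space := mul_nonneg (by linarith) (by linarith)
  linarith only [h4, h5]

end TwoPFA

theorem theorem6 :
    ∃ c : ℝ, 0 < c ∧
      ∀ (d n : ℕ), n = 3 ^ d →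
      ∀ (Q : Type*) [Fintype Q] (M : TwoPFA InputSymbol Q) (ε : ℝ), 0 ≤ ε → ε < 1 / 3 →
        M.Recognizes (LNE d) ε →
      ∀ T : ℝ≥0, (∀ w : List InputSymbol, w.length = 3 * n → M.expectedTime w ≤ (T : ℝ≥0∞)) →
        c * (n : ℝ) ^ 2 ≤ (T : ℝ) * M.space := by
  refine ⟨1 / 10 ^ 9, by norm_num, ?_⟩
  rintro d n rfl Q _ M ε - hε ⟨hacc, hrej⟩ T hT
  -- The strict inequality, available because ε < 1/3, ensures that a finite number of steps already
  -- rejects with probability above 2/3.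
  have hlt : (2 / 3 : ℝ≥0∞) < ENNReal.ofReal (1 - ε) := by
    have e : (2 / 3 : ℝ≥0∞) = ENNReal.ofReal (2 / 3) := by
      rw [ENNReal.ofReal_div_of_pos (by norm_num)]
      simp
    rw [e]
    exact (ENNReal.ofReal_lt_ofReal_iff (by linarith)).2 (by linarith)
  have h := M.sq_le_mul_time_mul_space (n := 3 ^ d) (by positivity)
    (fun x y hxy => hlt.trans_le (hrej _ fun hmem => by
      have h1 := (paddedWord_mem_LNE x y).1 hmem
      rw [RNE, NEiter_eq_false d hxy] at h1
      exact Bool.false_ne_true h1))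
    (fun x y ⟨i, hi, hj⟩ => hlt.le.trans (hacc _ ((paddedWord_mem_LNE x y).2
      (NEiter_eq_true d i hi hj))))
    (fun x y => hT _ (paddedWord_length x y))
  linarith only [h]
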